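/- Let $n\ge 4$ and let $\mathbf C_n=(\{0,\dots,n-1\};\wedge,\vee,\to,\bot,\top)$ be the $n$-element Heyting chain $0<1<\dots<n-1$, with $\bot=0$ and $\top=n-1$. Let $\mathcal G_n=\mathbb{ISP}(\mathbf C_n)$ be the class of Heyting algebras isomorphic to a subalgebra of a power of $\mathbf C_n$. For $1\le i\le n-3$ let $g_i$ be the partial endomorphism of $\mathbf C_n$ with domain $C_n\setminus\{i\}$ that sends $i+1$ to $i$ and fixes every other element of its domain, and let $f_i\colon C_n\setminus\{i+1\}\to C_n\setminus\{i\}$ be its inverse. For $1\le i\le n-2$ let $h_i$ be the endomorphism with $h_i(x)=x+1$ if $i\le x<n-1$ and $h_i(x)=x$ otherwise. Put $$\Sigma_n=\{f_1,g_1\}\times\dots\times\{f_{n-3},g_{n-3}\}\times\{h_1,\dots,h_{n-2}\}.$$ For $\sigma\in\Sigma_n$ let $\mathbf C_n^\sigma=(C_n;\sigma,\mathscr T)$, where $\mathscr T$ is the discrete topology, and let $\mathcal X^\sigma=\mathbb{IS}_c\mathbb P^+(\mathbf C_n^\sigma)$ be the class of topological structures isomorphic to a (possibly empty) closed substructure of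 a power of $\mathbf C_n^\sigma$. Here operations and partial operations are lifted pointwise to powers, a substructure is a subset closed under the (partial) operations wherever these are defined, and morphisms are the continuous maps preserving the (partial) operations. For $\mathbf A\in\mathcal G_n$ let $D(\mathbf A)$ be the set of homomorphisms $\mathbf A\to\mathbf C_n$, as a closed substructure of $(\mathbf C_n^\sigma)^A$. For $\mathbf X\in\mathcal X^\sigma$ let $E(\mathbf X)$ be the algebra, with pointwise operations, of all morphisms $\mathbf X\to\mathbf C_n^\sigma$. Say that $\mathbf C_n^\sigma$ *fully dualises* $\mathcal G_n$ if for every $\mathbf A\in\mathcal G_n$ the evaluation map $\mathbf A\to ED(\mathbf A)$, $a\mapsto(x\mapsto x(a))$, is an isomorphism, and $DE(\mathbf X)\cong\mathbf X$ for every $\mathbf X\in\mathcal X^\sigma$. **Theorem.** Let $n\ge4$ and $\sigma\in\Sigma_n$. Then $\mathbf C_n^\sigma$ fully dualises $\mathcal G_n$ if and only if $\sigma=(g_1,\dots,g_{n-3},h_1)$. Moreover, for every other $\sigma$ there is an explicit closed substructure of $\mathbf C_n^\sigma$ that is not isomorphic to $D(\mathbf A)$ for any $\mathbf A\in\mathcal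 G_n$: 1. if some $\sigma_i$ with $1\le i\le n-3$ equals $f_i$, and $j$ is the largest such $i$, then $\{j+1,\dots,n-1\}$ is such a substructure; 2. if $\sigma_i=g_i$ for all $1\le i\le n-3$ and $\sigma_{n-2}=h_k$ with $k\ne1$, then $\{1,n-1\}$ is such a substructure. -/

import Mathlib

universe u v w

namespace GodelDuality

section General

/-- A partial endomorphism of a Heyting algebra `M`: a partial map whose domain is a subalgebra
of `M` and which is a homomorphism from its domain to `M`.  (`y ∈ toPFun x` means that the map is
defined at `x` with value `y`.) -/
structure PartialEnd (M : Type w) [HeytingAlgebra M] where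
  toPFun : M →. M
  bot_mem : ⊥ ∈ toPFun ⊥
  top_mem : ⊤ ∈ toPFun ⊤
  inf_mem : ∀ {a b a' b' : M}, a' ∈ toPFun a → b' ∈ toPFun b → a' ⊓ b' ∈ toPFun (a ⊓ b)
  sup_mem : ∀ {a b a' b' : M}, a' ∈ toPFun a → b' ∈ toPFun b → a' ⊔ b' ∈ toPFun (a ⊔ b)
  himp_mem : ∀ {a b a' b' : M}, a' ∈ toPFun a → b' ∈ toPFun b → (a' ⇨ b') ∈ toPFun (a ⇨ b)

/-- A topological structure with an `I`-indexed family of partial unary operations (a total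
operation is one whose domain is everything).  The carrier may be empty. -/
structure TopStr (I : Type w) where
  carrier : Type u
  [top : TopologicalSpace carrier]
  op : I → carrier →. carrier

attribute [instance] TopStr.top

variable {I : Type w}

/-- Morphisms: continuous maps `φ` such that, whenever the `i`-th operation is defined at `x`, it is
defined at `φ x`, and `φ` carries the first value to the second. -/
structure TopStr.Hom (X : TopStr.{u} I) (Y : TopStr.{v} I) where
  toFun : X.carrier → Y.carrier
  continuous_toFun : Continuous toFun
  map_op : ∀ (i : I) (x x' : X.carrier), x' ∈ X.op i x → toFun x' ∈ Y.op i (toFun x)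

/-- Isomorphisms: homeomorphisms which preserve and reflect the graphs (hence also the domains) of
all the partial operations. -/
structure TopStr.Iso (X : TopStr.{u} I) (Y : TopStr.{v} I) where
  toHomeomorph : X.carrier ≃ₜ Y.carrier
  map_op_iff : ∀ (i : I) (x x' : X.carrier),
    toHomeomorph x' ∈ Y.op i (toHomeomorph x) ↔ x' ∈ X.op i x

/-- The power `Y ^ S`, with the product topology and pointwise lifted partial operations. -/
def TopStr.pow (Y : TopStr.{u} I) (S : Type v) : TopStr.{max u v} I where
  carrier := S → Y.carrier
  op i x := ⟨∀ s, (Y.op i (x s)).Dom, fun h s => (Y.op i (x s)).get (h s)⟩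

/-- `X` is closed under the partial operations of `Y` (wherever these are defined). -/
def TopStr.IsSub (Y : TopStr.{u} I) (X : Set Y.carrier) : Prop :=
  ∀ (i : I), ∀ x ∈ X, ∀ x' ∈ Y.op i x, x' ∈ X

/-- The substructure of `Y` on a set closed under the partial operations, with the subspace
topology; the domain of an operation on it is the intersection of its domain in `Y` with `X`. -/
def TopStr.sub (Y : TopStr.{u} I) (X : Set Y.carrier) (hX : Y.IsSub X) : TopStr.{u} I where
  carrier := X
  op i x := ⟨(Y.op i x.1).Dom,
    fun h => ⟨(Y.op i x.1).get h, hX i x.1 x.2 _ (Part.get_mem h)⟩⟩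

/-- `X ∈ IS_cP⁺(Y)`: `X` is isomorphic to a (possibly empty) closed substructure of a power of
`Y`. -/
def TopStr.InIScP (Y : TopStr.{v} I) (X : TopStr.{max u v} I) : Prop :=
  ∃ (S : Type u) (Z : Set (Y.pow S).carrier) (hZ : (Y.pow S).IsSub Z),
    IsClosed Z ∧ Nonempty (X.Iso ((Y.pow S).sub Z hZ))

/-- `A ∈ ISP(M)`: the Heyting algebra `A` embeds in a power of `M`. -/
def InISP (M : Type v) [HeytingAlgebra M] (A : Type u) [HeytingAlgebra A] : Prop :=
  ∃ (S : Type u) (f : HeytingHom A (S → M)), Function.Injective f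

variable {M : Type v} [HeytingAlgebra M]

/-- The alter ego `(M; R, discrete topology)` determined by a family `R` of partial
endomorphisms. -/
def alterEgo (R : I → PartialEnd M) : TopStr.{v} I where
  carrier := M
  top := ⊥
  op i := (R i).toPFun

instance (R : I → PartialEnd M) : DiscreteTopology (alterEgo R).carrier := ⟨rfl⟩

instance (R : I → PartialEnd M) : HeytingAlgebra (alterEgo R).carrier :=
  inferInstanceAs (HeytingAlgebra M)

variable (R : I → PartialEnd M)

/-- The set of homomorphisms `A → M`, as a subset of `M ^ A`. -/
def homSet (A : Type u) [HeytingAlgebra A] : Set ((alterEgo R).pow A).carrier :=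
  {x | ∃ f : HeytingHom A M, ∀ a, x a = f a}

theorem homSet_isSub (A : Type u) [HeytingAlgebra A] :
    ((alterEgo R).pow A).IsSub (homSet R A) := by
  rintro i x ⟨f, hf⟩ y hy
  have key : ∀ a, y a ∈ (R i).toPFun (f a) := by
    intro a
    obtain ⟨h, rfl⟩ := hy
    rw [← hf a]
    exact Part.get_mem (h a)
  refine ⟨{ toFun := y, map_sup' := ?_, map_inf' := ?_, map_bot' := ?_, map_himp' := ?_ },
    fun a => rfl⟩
  · intro a b
    have h := key (a ⊔ b)
    rw [map_sup] at h
    exact Part.mem_unique h ((R i).sup_mem (key a) (key b))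
  · intro a b
    have h := key (a ⊓ b)
    rw [map_inf] at h
    exact Part.mem_unique h ((R i).inf_mem (key a) (key b))
  · have h := key ⊥
    rw [map_bot] at h
    exact Part.mem_unique h (R i).bot_mem
  · intro a b
    have h := key (a ⇨ b)
    rw [map_himp] at h
    exact Part.mem_unique h ((R i).himp_mem (key a) (key b))

/-- The dual `D(A)` of a Heyting algebra `A`: the set of homomorphisms `A → M`, as a substructure
of the power `(alterEgo R) ^ A`. -/
def D (A : Type u) [HeytingAlgebra A] : TopStr.{max v u} I :=
  ((alterEgo R).pow A).sub (homSet R A) (homSet_isSub R A)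

/-- The dual `E(X)` of a structure `X`: the morphisms from `X` to the alter ego. -/
abbrev E (X : TopStr.{u} I) : Type (max u v) := X.Hom (alterEgo R)

namespace E

variable {R} {X : TopStr.{u} I}

/-- A morphism viewed as an element of the algebra `M ^ X`. -/
def val (f : E R X) : X.carrier → M := f.toFun

theorem val_injective : Function.Injective (val : E R X → X.carrier → M) := by
  rintro ⟨f, _, _⟩ ⟨g, _, _⟩ h
  cases h
  rfl

private theorem cont₂ (F : M → M → M) (f g : E R X) :
    Continuous (Y := (alterEgo R).carrier) fun x => F (f.toFun x) (g.toFun x) :=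
  Continuous.comp (Y := (alterEgo R).carrier × (alterEgo R).carrier) (Z := (alterEgo R).carrier)
    (g := fun p => F p.1 p.2) continuous_of_discreteTopology
    (f.continuous_toFun.prodMk g.continuous_toFun)

instance : Bot (E R X) := ⟨⟨fun _ => (⊥ : M), continuous_const (Y := (alterEgo R).carrier), fun i _ _ _ => (R i).bot_mem⟩⟩

instance : Top (E R X) := ⟨⟨fun _ => (⊤ : M), continuous_const (Y := (alterEgo R).carrier), fun i _ _ _ => (R i).top_mem⟩⟩

instance : Min (E R X) := ⟨fun f g => ⟨fun x => (f.toFun x ⊓ g.toFun x : M),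
  cont₂ (fun a b => a ⊓ b) f g,
  fun i x x' h => (R i).inf_mem (f.map_op i x x' h) (g.map_op i x x' h)⟩⟩

instance : Max (E R X) := ⟨fun f g => ⟨fun x => (f.toFun x ⊔ g.toFun x : M),
  cont₂ (fun a b => a ⊔ b) f g,
  fun i x x' h => (R i).sup_mem (f.map_op i x x' h) (g.map_op i x x' h)⟩⟩

instance : HImp (E R X) := ⟨fun f g => ⟨fun x => (f.toFun x ⇨ g.toFun x : M),
  cont₂ (fun a b => a ⇨ b) f g,
  fun i x x' h => (R i).himp_mem (f.map_op i x x' h) (g.map_op i x x' h)⟩⟩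

instance : Compl (E R X) := ⟨fun f => f ⇨ ⊥⟩

instance : LE (E R X) := ⟨fun f g => f.val ≤ g.val⟩

instance : LT (E R X) := ⟨fun f g => f.val < g.val⟩

/-- `E(X)` with the operations inherited pointwise from `M`. -/
instance : HeytingAlgebra (E R X) :=
  Function.Injective.heytingAlgebra (val : E R X → X.carrier → M) val_injective
    Iff.rfl Iff.rfl (fun _ _ => rfl) (fun _ _ => rfl) rfl rfl
    (fun f => himp_bot (f.val)) (fun _ _ => rfl)

end E

/-- The evaluation homomorphism `e_A : A → E(D(A))`, `e_A(a)(x) = x(a)`. -/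
def evalHom (A : Type u) [HeytingAlgebra A] : HeytingHom A (E R (D R A)) where
  toFun a :=
    { toFun := fun x => x.1 a
      continuous_toFun := (continuous_apply a).comp continuous_subtype_val
      map_op := by
        rintro i x x' ⟨h, rfl⟩
        exact Part.get_mem (h a) }
  map_sup' a b := E.val_injective <| funext fun x => by
    obtain ⟨f, hf⟩ := x.2
    change x.1 (a ⊔ b) = (x.1 a ⊔ x.1 b : M)
    rw [hf, hf, hf]
    exact map_sup (β := M) f a b
  map_inf' a b := E.val_injective <| funext fun x => by
    obtain ⟨f, hf⟩ := x.2
    change x.1 (a ⊓ b) = (x.1 a ⊓ x.1 b : M)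
    rw [hf, hf, hf]
    exact map_inf (β := M) f a b
  map_bot' := E.val_injective <| funext fun x => by
    obtain ⟨f, hf⟩ := x.2
    change x.1 ⊥ = (⊥ : M)
    rw [hf]
    exact map_bot f
  map_himp' a b := E.val_injective <| funext fun x => by
    obtain ⟨f, hf⟩ := x.2
    change x.1 (a ⇨ b) = (x.1 a ⇨ x.1 b : M)
    rw [hf, hf, hf]
    exact map_himp (β := M) f a b

/-- The alter ego given by `R` yields a duality on `ISP(M)`: for every `A ∈ ISP(M)` the evaluation
homomorphism `A → E(D(A))` is an isomorphism. -/
def Dualises : Prop :=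
  ∀ (A : Type u) [HeytingAlgebra A], InISP M A → Function.Bijective (evalHom R A)

/-- The alter ego given by `R` fully dualises `ISP(M)`: it yields a duality, and every structure
`X ∈ IS_cP⁺(alterEgo R)` is isomorphic to `D(E(X))`. -/
def FullyDualises : Prop :=
  Dualises.{max u v} R ∧
    ∀ X : TopStr.{max u v} I, TopStr.InIScP.{u} (alterEgo R) X → Nonempty ((D R (E R X)).Iso X)

/-- `X ⊆ M` is the universe of a closed substructure of the alter ego given by `R` which is not
isomorphic to the dual `D(A)` of any algebra `A ∈ ISP(M)`. -/
def IsClosedNonDual (X : Set M) : Prop :=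
  IsClosed (X := (alterEgo R).carrier) X ∧ ∃ hX : (alterEgo R).IsSub X,
    ∀ (A : Type u) [HeytingAlgebra A], InISP M A →
      IsEmpty (((alterEgo R).sub X hX).Iso (D R A))

end General

section Chain

/-- The `n`-element Heyting chain `0 < 1 < ⋯ < n - 1`. -/
abbrev C (n : ℕ) : Type := Fin n

variable (n : ℕ) [NeZero n]

theorem C_himp (a b : C n) : (a ⇨ b) = if a ≤ b then ⊤ else b := rfl

variable {n} in
/-- A partial map on the chain fixing `⊥` and `⊤`, monotone, and strictly monotone except possibly
where the larger value is `⊤`, is a partial endomorphism. -/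
def PartialEnd.ofChain (φ : C n →. C n) (hbot : ⊥ ∈ φ ⊥) (htop : ⊤ ∈ φ ⊤)
    (hlt : ∀ {a b a' b' : C n}, a' ∈ φ a → b' ∈ φ b → a < b → a' < b' ∨ (a' = ⊤ ∧ b' = ⊤)) :
    PartialEnd (C n) :=
  have hle : ∀ {a b a' b' : C n}, a' ∈ φ a → b' ∈ φ b → a ≤ b → a' ≤ b' := by
    intro a b a' b' ha hb h
    rcases h.lt_or_eq with h | rfl
    · rcases hlt ha hb h with h | ⟨rfl, rfl⟩
      · exact h.le
      · exact le_rfl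
    · exact (Part.mem_unique ha hb).le
  { toPFun := φ
    bot_mem := hbot
    top_mem := htop
    inf_mem := by
      intro a b a' b' ha hb
      rcases le_total a b with h | h
      · rwa [inf_eq_left.2 h, inf_eq_left.2 (hle ha hb h)]
      · rwa [inf_eq_right.2 h, inf_eq_right.2 (hle hb ha h)]
    sup_mem := by
      intro a b a' b' ha hb
      rcases le_total a b with h | h
      · rwa [sup_eq_right.2 h, sup_eq_right.2 (hle ha hb h)]
      · rwa [sup_eq_left.2 h, sup_eq_left.2 (hle hb ha h)]
    himp_mem := by
      intro a b a' b' ha hb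
      rcases le_or_gt a b with h | h
      · rwa [himp_eq_top_iff.2 h, himp_eq_top_iff.2 (hle ha hb h)]
      · rw [C_himp, C_himp, if_neg h.not_ge]
        rcases hlt hb ha h with h' | ⟨rfl, rfl⟩
        · rwa [if_neg h'.not_ge]
        · simpa using hb }

/-- For `1 ≤ i ≤ n - 3`, the partial endomorphism `g_i` with domain `C_n \ {i}`, which sends `i + 1`
to `i` and fixes all other elements of its domain. -/
def gMap (i : Set.Icc 1 (n - 3)) : PartialEnd (C n) :=
  PartialEnd.ofChain
    (fun x => ⟨x.val ≠ i.1,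
      fun _ => if x.val = i.1 + 1 then ⟨i.1, by have := i.2.1; have := i.2.2; omega⟩ else x⟩)
    (by
      obtain ⟨i, h1, h2⟩ := i
      refine ⟨?_, ?_⟩
      · change (0 : ℕ) ≠ i; omega
      · exact if_neg (t := (⟨i, by omega⟩ : C n)) (show ¬ (0 : ℕ) = i + 1 by omega))
    (by
      obtain ⟨i, h1, h2⟩ := i
      refine ⟨?_, ?_⟩
      · change n - 1 ≠ i; omega
      · exact if_neg (show ¬ n - 1 = i + 1 by omega))
    (by
      obtain ⟨i, h1, h2⟩ := i
      rintro a b a' b' ⟨ha, rfl⟩ ⟨hb, rfl⟩ h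
      left
      change a.val ≠ i at ha
      change b.val ≠ i at hb
      change (if a.val = i + 1 then _ else _) < (if b.val = i + 1 then _ else _)
      have h' : a.val < b.val := h
      split_ifs <;> rw [Fin.lt_def] <;> (try dsimp only) <;> omega)

/-- For `1 ≤ i ≤ n - 3`, the inverse `f_i` of `g_i`: its domain is `C_n \ {i + 1}`, it sends `i` to
`i + 1` and fixes all other elements of its domain. -/
def fMap (i : Set.Icc 1 (n - 3)) : PartialEnd (C n) :=
  PartialEnd.ofChain
    (fun x => ⟨x.val ≠ i.1 + 1,
      fun _ => if x.val = i.1 then ⟨i.1 + 1, by have := i.2.1; have := i.2.2; omega⟩ else x⟩)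
    (by
      obtain ⟨i, h1, h2⟩ := i
      refine ⟨?_, ?_⟩
      · change (0 : ℕ) ≠ i + 1; omega
      · exact if_neg (show ¬ (0 : ℕ) = i by omega))
    (by
      obtain ⟨i, h1, h2⟩ := i
      refine ⟨?_, ?_⟩
      · change n - 1 ≠ i + 1; omega
      · exact if_neg (show ¬ n - 1 = i by omega))
    (by
      obtain ⟨i, h1, h2⟩ := i
      rintro a b a' b' ⟨ha, rfl⟩ ⟨hb, rfl⟩ h
      left
      change a.val ≠ i + 1 at ha
      change b.val ≠ i + 1 at hb
      change (if a.val = i then _ else _) < (if b.val = i then _ else _)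
      have h' : a.val < b.val := h
      split_ifs <;> rw [Fin.lt_def] <;> (try dsimp only) <;> omega)

/-- For `1 ≤ i ≤ n - 2`, the endomorphism `h_i` with range `C_n \ {i}`: `h_i(x) = x + 1` if
`i ≤ x < n - 1` and `h_i(x) = x` otherwise. -/
def hMap (i : Set.Icc 1 (n - 2)) : PartialEnd (C n) :=
  PartialEnd.ofChain
    (fun x => Part.some
      (if hx : i.1 ≤ x.val ∧ x.val < n - 1 then ⟨x.val + 1, by omega⟩ else x))
    (by
      obtain ⟨i, h1, h2⟩ := i
      rw [Part.mem_some_iff, dif_neg]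
      rintro ⟨h, -⟩
      change i ≤ 0 at h
      omega)
    (by
      rw [Part.mem_some_iff, dif_neg]
      rintro ⟨-, h⟩
      change n - 1 < n - 1 at h
      omega)
    (by
      obtain ⟨i, h1, h2⟩ := i
      intro a b a' b' ha hb h
      rw [Part.mem_some_iff] at ha hb
      subst ha hb
      have h' : a.val < b.val := h
      have := b.2
      split_ifs <;> simp only [Fin.lt_def, Fin.ext_iff, Fin.val_top] <;> omega)

/-- `f_i` and `g_i` are mutually inverse partial maps. -/
theorem mem_fMap_iff (i : Set.Icc 1 (n - 3)) (x y : C n) :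
    y ∈ (fMap n i).toPFun x ↔ x ∈ (gMap n i).toPFun y := by
  obtain ⟨i, h1, h2⟩ := i
  change (∃ _ : x.val ≠ i + 1, (if x.val = i then _ else _) = y) ↔
    (∃ _ : y.val ≠ i, (if y.val = i + 1 then _ else _) = x)
  split_ifs <;> simp only [Fin.ext_iff] <;> grind

/-- The index set of the tuples in `Σ_n`: the indices `1, …, n - 3` of the partial endomorphisms,
and one more index for the endomorphism. -/
abbrev Idx : Type := Set.Icc 1 (n - 3) ⊕ Unit

/-- `Σ_n = {f_1, g_1} × ⋯ × {f_{n-3}, g_{n-3}} × {h_1, …, h_{n-2}}`. -/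
def SigmaTuples : Set (Idx n → PartialEnd (C n)) :=
  {σ | (∀ i, σ (Sum.inl i) = fMap n i ∨ σ (Sum.inl i) = gMap n i) ∧ ∃ k, σ (Sum.inr ()) = hMap n k}

/-- The tuple `(g_1, …, g_{n-3}, h_1)`, for `n ≥ 4`. -/
def gh₁ (hn : 4 ≤ n) : Idx n → PartialEnd (C n) :=
  Sum.elim (gMap n) (fun _ => hMap n ⟨1, le_rfl, by omega⟩)

end Chain

end GodelDuality

/-!
For `R = (g_1, …, g_{n-3}, h_1)`, a homomorphism `A → C_n` with a larger kernel (filter of elements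
sent to `⊤`) than `x : D(A)` is `e ∘ x` for some map `e`, and it is reachable from `x` by successive
operations: the `g_i` lower the values of `e` one at a time, and `h_1` raises all of them at once.

* Fullness: by compactness of `X` and primeness of `⊤`, the kernel of every homomorphism
  `E(X) → C_n` contains that of an evaluation at a point. The homomorphism is then reachable from
  this evaluation, and the evaluations are closed under the operations.
* Duality: a morphism `D(A) → C_n` is determined along reachability by its value at the start, which
  makes elements of `A` interpolate it at any two points. A Stone–Weierstrass argument
  finishes.

In all other cases, a point of a dual with a value other than `⊥` and `⊤` forces the dual to have
at least `n - 1` points, whereas a point without such values is fixed by every operation. A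
substructure with fewer points, one of them outside the domain of some operation, is thus no dual.
-/

namespace GodelDuality

section Structures

variable {I : Type w}

namespace TopStr

theorem mem_pow_op {Y : TopStr.{v} I} {S : Type u} {i : I} {x x' : (Y.pow S).carrier} :
    x' ∈ (Y.pow S).op i x ↔ ∀ s, x' s ∈ Y.op i (x s) := by
  constructor
  · rintro ⟨h, rfl⟩ s
    exact Part.get_mem (h s)
  · exact fun h => ⟨fun s => (h s).1, funext fun s => (h s).2⟩

theorem mem_sub_op {Y : TopStr.{v} I} {X : Set Y.carrier} {hX : Y.IsSub X} {i : I}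
    {x x' : (Y.sub X hX).carrier} : x' ∈ (Y.sub X hX).op i x ↔ x'.1 ∈ Y.op i x.1 := by
  constructor
  · rintro ⟨h, rfl⟩
    exact Part.get_mem (o := Y.op i x.1) h
  · exact fun ⟨h, h'⟩ => ⟨h, Subtype.ext h'⟩

instance (Y : TopStr.{v} I) [Finite Y.carrier] (S : Type u) : CompactSpace (Y.pow S).carrier :=
  inferInstanceAs (CompactSpace (S → Y.carrier))

instance (Y : TopStr.{v} I) [T2Space Y.carrier] (S : Type u) : T2Space (Y.pow S).carrier :=
  inferInstanceAs (T2Space (S → Y.carrier))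

theorem continuous_coord {Y : TopStr.{v} I} {S : Type u} {Z : Set (Y.pow S).carrier}
    {hZ : (Y.pow S).IsSub Z} (s : S) :
    Continuous fun z : ((Y.pow S).sub Z hZ).carrier => z.1 s :=
  (continuous_apply s).comp (continuous_subtype_val (p := (· ∈ Z)))

/-- Reachability: `x'` arises from `x` by successive application of operations, that is, `x'` lies
in the substructure generated by `x`. -/
def Reach (X : TopStr.{u} I) : X.carrier → X.carrier → Prop :=
  Relation.ReflTransGen fun x x' => ∃ i, x' ∈ X.op i x

variable {X : TopStr.{u} I} {Y : TopStr.{v} I}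

theorem reach_of_mem_op {x x' : X.carrier} (i : I) (h : x' ∈ X.op i x) : X.Reach x x' :=
  .single ⟨i, h⟩

theorem Reach.to_sub {Z : Set X.carrier} {hZ : X.IsSub Z} {x : (X.sub Z hZ).carrier}
    {z : X.carrier} (h : X.Reach x.1 z) : ∃ hz : z ∈ Z, (X.sub Z hZ).Reach x ⟨z, hz⟩ := by
  induction h with
  | refl => exact ⟨x.2, .refl⟩
  | tail _ hstep ih =>
    obtain ⟨hz, hreach⟩ := ih
    obtain ⟨i, hi⟩ := hstep
    exact ⟨hZ i _ hz _ hi, hreach.tail ⟨i, mem_sub_op.2 hi⟩⟩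

theorem Hom.eq_of_reach (φ ψ : X.Hom Y) {x x' : X.carrier} (h : X.Reach x x')
    (hx : φ.toFun x = ψ.toFun x) : φ.toFun x' = ψ.toFun x' := by
  induction h with
  | refl => exact hx
  | tail _ hstep ih =>
    obtain ⟨i, hi⟩ := hstep
    exact Part.mem_unique (φ.map_op i _ _ hi) (ih ▸ ψ.map_op i _ _ hi)

theorem Hom.dom_op (φ : X.Hom Y) {i : I} {x : X.carrier} (h : (X.op i x).Dom) :
    (Y.op i (φ.toFun x)).Dom :=
  (φ.map_op i x _ (Part.get_mem h)).1

/-- The inverse of an isomorphism of structures. -/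
def Iso.symm (Θ : X.Iso Y) : Y.Iso X where
  toHomeomorph := Θ.toHomeomorph.symm
  map_op_iff i y y' := by
    rw [← Θ.map_op_iff, Θ.toHomeomorph.apply_symm_apply, Θ.toHomeomorph.apply_symm_apply]

/-- The composite of two isomorphisms of structures. -/
def Iso.trans {Z : TopStr I} (Θ : X.Iso Y) (Λ : Y.Iso Z) : X.Iso Z where
  toHomeomorph := Θ.toHomeomorph.trans Λ.toHomeomorph
  map_op_iff i x x' := (Λ.map_op_iff i _ _).trans (Θ.map_op_iff i x x')

theorem InIScP.compactSpace [Finite Y.carrier] {X : TopStr.{max u v} I}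
    (hX : InIScP.{u} Y X) : CompactSpace X.carrier := by
  obtain ⟨S, Z, hZ, hclosed, ⟨Θ⟩⟩ := hX
  have : CompactSpace ((Y.pow S).sub Z hZ).carrier := isCompact_iff_compactSpace.1 hclosed.isCompact
  exact Θ.toHomeomorph.symm.compactSpace

end TopStr

end Structures

section Dual

variable {I : Type w} {M : Type v} [HeytingAlgebra M] {R : I → PartialEnd M}
  {A : Type u} [HeytingAlgebra A]

instance [Finite M] : Finite (alterEgo R).carrier := inferInstanceAs (Finite M)

variable (R) in
/-- The point of the dual `D(A)` given by a homomorphism. -/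
def ofHom (f : HeytingHom A M) : (D R A).carrier :=
  ⟨fun a => f a, f, fun _ => rfl⟩

theorem exists_ofHom_eq (x : (D R A).carrier) : ∃ f : HeytingHom A M, ofHom R f = x := by
  obtain ⟨x, f, hf⟩ := x
  exact ⟨f, Subtype.ext (funext fun a => (hf a).symm)⟩

variable (A) in
theorem isClosed_homSet : IsClosed (homSet R A) := by
  have isClosed_setOf_apply_eq (F : M → M → M) (a b c : A) :
      IsClosed {x : ((alterEgo R).pow A).carrier | x c = F (x a) (x b)} :=
    have hF : Continuous (Y := (alterEgo R).carrier)
        fun p : (alterEgo R).carrier × (alterEgo R).carrier => F p.1 p.2 :=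
      continuous_of_discreteTopology
    have hab : Continuous fun x : ((alterEgo R).pow A).carrier => (x a, x b) :=
      (continuous_apply a).prodMk (continuous_apply b)
    isClosed_eq (X := (alterEgo R).carrier) (continuous_apply c) (hF.comp hab)
  have homSet_eq : homSet R A = ⋂ (a : A) (b : A),
      {x | x (a ⊔ b) = (x a ⊔ x b : M)} ∩ {x | x (a ⊓ b) = (x a ⊓ x b : M)} ∩
        {x | x (a ⇨ b) = (x a ⇨ x b : M)} ∩ {x | x ⊥ = (⊥ : M)} := by
    ext x
    simp only [Set.mem_iInter, Set.mem_inter_iff, Set.mem_ofPred_eq]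
    constructor
    · rintro ⟨f, hf⟩ a b
      obtain rfl : x = fun a => f a := funext hf
      exact ⟨⟨⟨map_sup f a b, map_inf f a b⟩, map_himp f a b⟩, map_bot f⟩
    · intro h
      exact ⟨{ toFun := x
               map_sup' := fun a b => (h a b).1.1.1
               map_inf' := fun a b => (h a b).1.1.2
               map_himp' := fun a b => (h a b).1.2
               map_bot' := (h ⊥ ⊥).2 }, fun _ => rfl⟩
  rw [homSet_eq]
  exact isClosed_iInter fun a => isClosed_iInter fun b =>
    (((isClosed_setOf_apply_eq (· ⊔ ·) _ _ _).inter (isClosed_setOf_apply_eq (· ⊓ ·) _ _ _)).inter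
      (isClosed_setOf_apply_eq (· ⇨ ·) _ _ _)).inter
      (isClosed_setOf_apply_eq (fun _ _ => ⊥) a a _)

instance [Finite M] : CompactSpace (D R A).carrier :=
  isCompact_iff_compactSpace.1 (isClosed_homSet (R := R) A).isCompact

instance : T2Space (D R A).carrier := inferInstanceAs (T2Space (homSet R A))

variable (R A) in
/-- The alter ego is rich enough to reach, from any point of `D(A)`, every point whose kernel (the
filter of elements sent to `⊤`) is larger. -/
def ReachesLargerKernels : Prop :=
  ∀ x y : (D R A).carrier, (∀ a, x.1 a = (⊤ : M) → y.1 a = (⊤ : M)) → (D R A).Reach x y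

/-- The projection of a power of `M` to the factor indexed by `s`. -/
def powEval {S : Type u} (s : S) : HeytingHom (S → M) M where
  toFun x := x s
  map_sup' _ _ := rfl
  map_inf' _ _ := rfl
  map_bot' := rfl
  map_himp' _ _ := rfl

variable (R) in
theorem evalHom_injective (hA : InISP M A) : Function.Injective (evalHom R A) := by
  obtain ⟨S, f, hf⟩ := hA
  exact fun a b hab => hf <| funext fun s =>
    congrFun (congrArg E.val hab) (ofHom R ((powEval s).comp f))

/-- The inclusion of `E(X)` in the algebra `M ^ X`. -/
def E.valHom (R : I → PartialEnd M) (X : TopStr.{u} I) : HeytingHom (E R X) (X.carrier → M) where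
  toFun := E.val
  map_sup' _ _ := rfl
  map_inf' _ _ := rfl
  map_bot' := rfl
  map_himp' _ _ := rfl

theorem inISP_E (X : TopStr.{max u v} I) : InISP M (E R X) :=
  ⟨X.carrier, E.valHom R X, E.val_injective⟩

/-- Evaluation at a point `x`, as a homomorphism `E(X) → M`. -/
def pointHom (R : I → PartialEnd M) {X : TopStr.{u} I} (x : X.carrier) :
    HeytingHom (E R X) M :=
  (powEval x).comp (E.valHom R X)

end Dual

section LatticeInterpolation

variable {X M : Type*} [TopologicalSpace X] [Lattice M] [TopologicalSpace M] [DiscreteTopology M]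

theorem isOpen_setOf_le_of_discrete {f g : X → M} (hf : Continuous f) (hg : Continuous g) :
    IsOpen {x | f x ≤ g x} :=
  (isOpen_discrete {p : M × M | p.1 ≤ p.2}).preimage (hf.prodMk hg)

variable [CompactSpace X] {T : Set (X → M)} {φ : X → M}

theorem exists_ge_of_forall_exists (hsup : SupClosed T) (hcont : ∀ f ∈ T, Continuous f)
    (hφ : Continuous φ) (y : X) (h : ∀ x, ∃ f ∈ T, φ x ≤ f x ∧ f y ≤ φ y) :
    ∃ f ∈ T, φ ≤ f ∧ f y ≤ φ y := by
  have : Nonempty {f // f ∈ T ∧ f y ≤ φ y} :=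
    have ⟨f, hf, _, hfy⟩ := h y
    ⟨f, hf, hfy⟩
  obtain ⟨⟨f, hf, hfy⟩, hφf⟩ := isCompact_univ.elim_directed_cover
    (fun f : {f // f ∈ T ∧ f y ≤ φ y} => {x | φ x ≤ f.1 x})
    (fun f => isOpen_setOf_le_of_discrete hφ (hcont f.1 f.2.1))
    (fun x _ =>
      have ⟨f, hf, hfx, hfy⟩ := h x
      Set.mem_iUnion.2 ⟨⟨f, hf, hfy⟩, hfx⟩)
    (fun f g => ⟨⟨f.1 ⊔ g.1, hsup f.2.1 g.2.1, sup_le f.2.2 g.2.2⟩,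
      fun _ hx => le_sup_of_le_left hx, fun _ hx => le_sup_of_le_right hx⟩)
  exact ⟨f, hf, fun x => hφf (Set.mem_univ x), hfy⟩

/-- The Stone–Weierstrass argument for lattices of functions into a discrete lattice. -/
theorem mem_of_forall_exists_interpolant (hne : T.Nonempty) (hsup : SupClosed T)
    (hinf : InfClosed T) (hcont : ∀ f ∈ T, Continuous f) (hφ : Continuous φ)
    (h : ∀ x y, ∃ f ∈ T, φ x ≤ f x ∧ f y ≤ φ y) : φ ∈ T := by
  have hge (y : X) : ∃ f ∈ T, φ ≤ f ∧ f y ≤ φ y :=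
    exists_ge_of_forall_exists hsup hcont hφ y fun x => h x y
  have : Nonempty {f // f ∈ T ∧ φ ≤ f} := by
    rcases isEmpty_or_nonempty X with _ | ⟨⟨y⟩⟩
    · exact hne.elim fun f hf => ⟨f, hf, isEmptyElim⟩
    · have ⟨f, hf, hφf, _⟩ := hge y
      exact ⟨f, hf, hφf⟩
  obtain ⟨⟨f, hf, hφf⟩, hfφ⟩ := isCompact_univ.elim_directed_cover
    (fun f : {f // f ∈ T ∧ φ ≤ f} => {y | f.1 y ≤ φ y})
    (fun f => isOpen_setOf_le_of_discrete (hcont f.1 f.2.1) hφ)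
    (fun y _ =>
      have ⟨f, hf, hφf, hfy⟩ := hge y
      Set.mem_iUnion.2 ⟨⟨f, hf, hφf⟩, hfy⟩)
    (fun f g => ⟨⟨f.1 ⊓ g.1, hinf f.2.1 g.2.1, le_inf f.2.2 g.2.2⟩,
      fun _ hy => inf_le_of_left_le hy, fun _ hy => inf_le_of_right_le hy⟩)
  rwa [hφf.antisymm fun y => hfφ (Set.mem_univ y)]

end LatticeInterpolation

section FullDuality

variable {I : Type w} {M : Type v} [HeytingAlgebra M] {R : I → PartialEnd M}

theorem exists_pointHom_ker_le {X : TopStr.{u} I} [CompactSpace X.carrier]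
    (htop : SupPrime (⊤ : M)) (g : HeytingHom (E R X) M) :
    ∃ x : X.carrier, ∀ f, pointHom R x f = ⊤ → g f = ⊤ := by
  by_contra! hne
  have hbot : (⊥ : M) ≠ ⊤ := fun h => htop.1 (h ▸ isMin_bot)
  have : Nonempty {f : E R X // g f ≠ ⊤} := ⟨⊥, by rwa [map_bot]⟩
  obtain ⟨⟨f, hgf⟩, hf⟩ := isCompact_univ.elim_directed_cover
    (fun f : {f : E R X // g f ≠ ⊤} => {x | f.1.toFun x = (⊤ : M)})
    (fun f => (isOpen_discrete (α := (alterEgo R).carrier) {⊤}).preimage f.1.continuous_toFun)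
    (fun x _ =>
      have ⟨f, hf, hgf⟩ := hne x
      Set.mem_iUnion.2 ⟨⟨f, hgf⟩, hf⟩)
    (fun f f' => by
      have hsup : g (f.1 ⊔ f'.1) ≠ ⊤ := fun h => by
        rw [map_sup] at h
        exact (htop.2 h.ge).elim (fun h => f.2 (top_le_iff.1 h)) fun h => f'.2 (top_le_iff.1 h)
      refine ⟨⟨f.1 ⊔ f'.1, hsup⟩, fun x hx => ?_, fun x hx => ?_⟩
      · exact eq_top_mono (α := M) le_sup_left hx
      · exact eq_top_mono (α := M) le_sup_right hx)
  have hf_top : f = ⊤ := E.val_injective (funext fun x => hf (Set.mem_univ x))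
  exact hgf (hf_top ▸ map_top g)

variable (R) in
/-- The comparison morphism `X → D(E(X))`, which sends a point to the evaluation at it. -/
def coeval (X : TopStr.{u} I) : X.Hom (D R (E R X)) where
  toFun x := ofHom R (pointHom R x)
  continuous_toFun :=
    Continuous.subtype_mk (continuous_pi fun f : E R X => f.continuous_toFun) _
  map_op i x x' h := TopStr.mem_sub_op.2 (TopStr.mem_pow_op.2 fun f => f.map_op i x x' h)

/-- The coordinate morphism at `s` of a structure embedded in a power of the alter ego. -/
def coordHom {X : TopStr.{u} I} {S : Type*} {Z : Set ((alterEgo R).pow S).carrier}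
    {hZ : ((alterEgo R).pow S).IsSub Z} (Θ : X.Iso (((alterEgo R).pow S).sub Z hZ)) (s : S) :
    E R X where
  toFun x := (Θ.toHomeomorph x).1 s
  continuous_toFun := (TopStr.continuous_coord s).comp Θ.toHomeomorph.continuous
  map_op i x x' h := TopStr.mem_pow_op.1 (TopStr.mem_sub_op.1 ((Θ.map_op_iff i x x').2 h)) s

variable {X : TopStr.{max u v} I}

theorem coeval_injective (hX : TopStr.InIScP.{u} (alterEgo R) X) :
    Function.Injective (coeval R X).toFun := by
  obtain ⟨S, Z, hZ, -, ⟨Θ⟩⟩ := hX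
  intro x y hxy
  refine Θ.toHomeomorph.injective (Subtype.ext (funext fun s => ?_))
  exact congrFun (congrArg Subtype.val hxy) (coordHom Θ s)

theorem exists_mem_op_of_mem_op_coeval (hX : TopStr.InIScP.{u} (alterEgo R) X) {i : I}
    {x : X.carrier} {z : (D R (E R X)).carrier}
    (hz : z ∈ (D R (E R X)).op i ((coeval R X).toFun x)) :
    ∃ x' ∈ X.op i x, (coeval R X).toFun x' = z := by
  obtain ⟨S, Z, hZ, -, ⟨Θ⟩⟩ := hX
  have hz_apply : ∀ f : E R X, z.1 f ∈ (R i).toPFun (f.val x) :=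
    TopStr.mem_pow_op.1 (TopStr.mem_sub_op.1 hz)
  let w : ((alterEgo R).pow S).carrier := fun s => z.1 (coordHom Θ s)
  have hw : w ∈ ((alterEgo R).pow S).op i (Θ.toHomeomorph x).1 :=
    TopStr.mem_pow_op.2 fun s => hz_apply (coordHom Θ s)
  obtain ⟨x', hx'⟩ := Θ.toHomeomorph.surjective ⟨w, hZ i _ (Θ.toHomeomorph x).2 _ hw⟩
  have hop : x' ∈ X.op i x :=
    (Θ.map_op_iff i x x').1 (TopStr.mem_sub_op.2 (by rwa [hx']))
  exact ⟨x', hop, Subtype.ext (funext fun f =>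
    Part.mem_unique (f.map_op i x x' hop) (hz_apply f))⟩

theorem coeval_surjective [Finite M] (htop : SupPrime (⊤ : M))
    (hR : ReachesLargerKernels R (E R X)) (hX : TopStr.InIScP.{u} (alterEgo R) X) :
    Function.Surjective (coeval R X).toFun := by
  intro z
  obtain ⟨g, rfl⟩ := exists_ofHom_eq z
  have := hX.compactSpace
  obtain ⟨x, hx⟩ := exists_pointHom_ker_le htop g
  suffices h : ∀ z, (D R (E R X)).Reach ((coeval R X).toFun x) z → ∃ y, (coeval R X).toFun y = z
    from h _ (hR _ _ hx)
  intro z hreach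
  induction hreach with
  | refl => exact ⟨x, rfl⟩
  | tail _ hstep ih =>
    obtain ⟨y, rfl⟩ := ih
    obtain ⟨i, hi⟩ := hstep
    obtain ⟨y', -, hy'⟩ := exists_mem_op_of_mem_op_coeval hX hi
    exact ⟨y', hy'⟩

theorem nonempty_iso_of_reachesLargerKernels [Finite M] (htop : SupPrime (⊤ : M))
    (hR : ReachesLargerKernels R (E R X)) (hX : TopStr.InIScP.{u} (alterEgo R) X) :
    Nonempty ((D R (E R X)).Iso X) := by
  have := hX.compactSpace
  have hinj := coeval_injective hX
  let ε : X.carrier ≃ₜ (D R (E R X)).carrier :=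
    Continuous.homeoOfEquivCompactToT2
      (f := Equiv.ofBijective _ ⟨hinj, coeval_surjective htop hR hX⟩)
      (coeval R X).continuous_toFun
  let Θ : X.Iso (D R (E R X)) :=
    { toHomeomorph := ε
      map_op_iff := fun i x x' => by
        refine ⟨fun h => ?_, (coeval R X).map_op i x x'⟩
        obtain ⟨y, hy, hyx'⟩ := exists_mem_op_of_mem_op_coeval hX h
        exact hinj hyx' ▸ hy }
  exact ⟨Θ.symm⟩

end FullDuality

section ChainMaps

variable {n : ℕ} [NeZero n]

theorem mem_gMap (i : Set.Icc 1 (n - 3)) (x y : C n) :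
    y ∈ (gMap n i).toPFun x ↔ x.val ≠ i.1 ∧ y.val = if x.val = i.1 + 1 then i.1 else x.val := by
  change (∃ _ : x.val ≠ i.1, (if x.val = i.1 + 1 then _ else _) = y) ↔ _
  split_ifs <;> simp only [Fin.ext_iff] <;> grind

theorem mem_hMap (i : Set.Icc 1 (n - 2)) (x y : C n) :
    y ∈ (hMap n i).toPFun x ↔
      y.val = if i.1 ≤ x.val ∧ x.val < n - 1 then x.val + 1 else x.val := by
  change y ∈ Part.some (if hx : i.1 ≤ x.val ∧ x.val < n - 1 then _ else _) ↔ _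
  rw [Part.mem_some_iff, Fin.ext_iff]
  split_ifs <;> simp

theorem eq_bot_iff_val {x : C n} : x = ⊥ ↔ x.val = 0 := Fin.ext_iff

theorem eq_top_iff_val {x : C n} : x = ⊤ ↔ x.val = n - 1 := by rw [Fin.ext_iff, Fin.val_top]

/-- `e` restricts on `K ∪ {⊥, ⊤}` to a homomorphism of Heyting chains. -/
structure IsHomOn (e : C n → C n) (K : Set (C n)) : Prop where
  apply_bot : e ⊥ = ⊥
  apply_top : e ⊤ = ⊤
  lt_or_eq_top : ∀ a ∈ K, ∀ b ∈ K, a < b → e a < e b ∨ (e a = ⊤ ∧ e b = ⊤)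

namespace IsHomOn

variable {K : Set (C n)} {e : C n → C n}

theorem id (K : Set (C n)) : IsHomOn id K := ⟨rfl, rfl, fun _ _ _ _ => .inl⟩

theorem le (he : IsHomOn e K) {a b : C n} (ha : a ∈ K) (hb : b ∈ K) (hab : a ≤ b) :
    e a ≤ e b := by
  rcases hab.lt_or_eq with hab | rfl
  · rcases he.lt_or_eq_top a ha b hb hab with h | ⟨ha', hb'⟩
    · exact h.le
    · rw [ha', hb']
  · exact le_rfl

theorem comp {d : C n → C n} (hd : IsHomOn d (e '' K)) (he : IsHomOn e K) :
    IsHomOn (d ∘ e) K where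
  apply_bot := by rw [Function.comp_apply, he.apply_bot, hd.apply_bot]
  apply_top := by rw [Function.comp_apply, he.apply_top, hd.apply_top]
  lt_or_eq_top a ha b hb hab := by
    rcases he.lt_or_eq_top a ha b hb hab with h | ⟨ha', hb'⟩
    · exact hd.lt_or_eq_top _ ⟨a, ha, rfl⟩ _ ⟨b, hb, rfl⟩ h
    · exact .inr ⟨by rw [Function.comp_apply, ha', hd.apply_top],
        by rw [Function.comp_apply, hb', hd.apply_top]⟩

/-- The partial endomorphism with domain `K` which agrees with `e` on `K`. -/
def toPartialEnd (he : IsHomOn e K) (hbot : ⊥ ∈ K) (htop : ⊤ ∈ K) : PartialEnd (C n) :=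
  PartialEnd.ofChain (PFun.res e K) ((PFun.mem_res ..).2 ⟨hbot, he.apply_bot⟩)
    ((PFun.mem_res ..).2 ⟨htop, he.apply_top⟩) fun ha hb hab => by
      obtain ⟨haK, rfl⟩ := (PFun.mem_res ..).1 ha
      obtain ⟨hbK, rfl⟩ := (PFun.mem_res ..).1 hb
      exact he.lt_or_eq_top _ haK _ hbK hab

end IsHomOn

variable {A : Type u} [HeytingAlgebra A]

theorem PartialEnd.exists_heytingHom {M : Type v} [HeytingAlgebra M] (p : PartialEnd M)
    (f : HeytingHom A M) {g : A → M} (h : ∀ a, g a ∈ p.toPFun (f a)) :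
    ∃ g' : HeytingHom A M, ∀ a, g' a = g a := by
  obtain ⟨g', hg'⟩ := homSet_isSub (fun _ : Unit => p) A () (fun a => f a) ⟨f, fun _ => rfl⟩ g
    (TopStr.mem_pow_op.2 h)
  exact ⟨g', fun a => (hg' a).symm⟩

theorem IsHomOn.exists_heytingHom {f : HeytingHom A (C n)} {e : C n → C n}
    (he : IsHomOn e (Set.range f)) : ∃ g : HeytingHom A (C n), ∀ a, g a = e (f a) :=
  (he.toPartialEnd ⟨⊥, map_bot f⟩ ⟨⊤, map_top f⟩).exists_heytingHom f fun a =>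
    (PFun.mem_res ..).2 ⟨⟨a, rfl⟩, rfl⟩

theorem exists_isHomOn_factor (f g : HeytingHom A (C n)) (h : ∀ a, f a = ⊤ → g a = ⊤) :
    ∃ e : C n → C n, IsHomOn e (Set.range f) ∧ ∀ a, g a = e (f a) := by
  have le_of_le (a b : A) (hab : f a ≤ f b) : g a ≤ g b := by
    rw [← himp_eq_top_iff, ← map_himp]
    exact h _ (by rw [map_himp, himp_eq_top_iff.2 hab])
  have hfactors : Function.FactorsThrough g f := fun a b hab =>
    le_antisymm (le_of_le a b hab.le) (le_of_le b a hab.ge)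
  have extend_apply (a : A) : Function.extend f g id (f a) = g a := hfactors.extend_apply id a
  refine ⟨Function.extend f g id, ⟨?_, ?_, ?_⟩, fun a => (extend_apply a).symm⟩
  · rw [← map_bot f, extend_apply, map_bot, map_bot]
  · rw [← map_top f, extend_apply, map_top, map_top]
  · rintro _ ⟨a, rfl⟩ _ ⟨b, rfl⟩ hab
    rw [extend_apply, extend_apply]
    refine (le_of_le a b hab.le).lt_or_eq.imp_right fun hgab => ?_
    have g_himp : g (b ⇨ a) = g a :=
      hfactors (by rw [map_himp, C_himp, if_neg hab.not_ge])
    have ga_top : g a = ⊤ := by rw [← g_himp, map_himp, hgab, himp_self]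
    exact ⟨ga_top, hgab ▸ ga_top⟩

end ChainMaps

section Reach

variable {n : ℕ}

/-- The map obtained from `e` by decreasing the value at `r` by one. -/
def lowerAt (e : C n → C n) (r : C n) : C n → C n :=
  Function.update e r ⟨(e r).val - 1, (Nat.sub_le _ _).trans_lt (e r).isLt⟩

theorem val_lowerAt_self (e : C n → C n) (r : C n) : (lowerAt e r r).val = (e r).val - 1 := by
  rw [lowerAt, Function.update_self]

theorem lowerAt_of_ne (e : C n → C n) {r s : C n} (h : s ≠ r) : lowerAt e r s = e s :=
  Function.update_of_ne h ..

theorem lowerAt_lt {e : C n → C n} {r : C n} (hpos : 0 < (e r).val) : lowerAt e r < e :=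
  update_lt_self_iff.2 (Nat.sub_lt hpos one_pos)

/-- The total map underlying `h₁`. -/
def shiftUp (v : C n) : C n :=
  if hv : 1 ≤ v.val ∧ v.val < n - 1 then ⟨v.val + 1, by omega⟩ else v

theorem val_shiftUp (v : C n) :
    (shiftUp v).val = if 1 ≤ v.val ∧ v.val < n - 1 then v.val + 1 else v.val := by
  rw [shiftUp]
  split_ifs <;> rfl

variable [NeZero n] {K : Set (C n)} {e e' : C n → C n}

theorem IsHomOn.lowerAt (he : IsHomOn e K) {r : C n} (hr : r ∈ K) (htop : e r ≠ ⊤)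
    (hpos : 1 < (e r).val) (hgap : ∀ s ∈ K, s < r → (e s).val + 1 < (e r).val) :
    IsHomOn (lowerAt e r) K where
  apply_bot := by
    rw [lowerAt_of_ne, he.apply_bot]
    rintro rfl
    rw [eq_bot_iff_val.1 he.apply_bot] at hpos
    omega
  apply_top := by rw [lowerAt_of_ne e (by rintro rfl; exact htop he.apply_top), he.apply_top]
  lt_or_eq_top a ha b hb hab := by
    rcases eq_or_ne a r with rfl | har
    · rw [lowerAt_of_ne e hab.ne', Fin.lt_def, val_lowerAt_self]
      have hlt := (he.lt_or_eq_top a ha b hb hab).resolve_right fun h => htop h.1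
      exact .inl ((Nat.sub_le _ _).trans_lt hlt)
    rcases eq_or_ne b r with rfl | hbr
    · rw [lowerAt_of_ne e hab.ne, Fin.lt_def, val_lowerAt_self]
      have := hgap a ha hab
      exact .inl (by omega)
    · rw [lowerAt_of_ne e har, lowerAt_of_ne e hbr]
      exact he.lt_or_eq_top a ha b hb hab

theorem exists_lowerAt_mem_gMap (he : IsHomOn e K) {r : C n} (hr : r ∈ K) (htop : e r ≠ ⊤)
    (hpos : 1 < (e r).val) (hgap : ∀ s ∈ K, s < r → (e s).val + 1 < (e r).val) :
    ∃ i, ∀ s ∈ K, lowerAt e r s ∈ (gMap n i).toPFun (e s) := by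
  have hr_lt := (e r).isLt
  rw [Ne, eq_top_iff_val] at htop
  refine ⟨⟨(e r).val - 1, by omega, by omega⟩, fun s hs => (mem_gMap _ _ _).2 ?_⟩
  dsimp only
  rcases lt_trichotomy s r with hsr | rfl | hsr
  · have := hgap s hs hsr
    rw [lowerAt_of_ne e hsr.ne, if_neg (by omega)]
    exact ⟨by omega, rfl⟩
  · rw [val_lowerAt_self, if_pos (by omega)]
    exact ⟨by omega, rfl⟩
  · have hlt : (e r).val < (e s).val :=
      (he.lt_or_eq_top r hr s hs hsr).resolve_right fun h => htop (eq_top_iff_val.1 h.1)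
    rw [lowerAt_of_ne e hsr.ne', if_neg (by omega)]
    exact ⟨by omega, rfl⟩

/-- The smallest argument where `e'` is below `e` leaves room to lower the value of `e`. -/
theorem exists_room_of_lt (hbot : ⊥ ∈ K) (he' : IsHomOn e' K) (he : IsHomOn e K)
    (hle : ∀ s ∈ K, e' s ≤ e s) (htop : ∀ s ∈ K, e s = ⊤ → e' s = ⊤)
    (hne : ∃ r, r ∈ K ∧ e' r < e r) :
    ∃ r ∈ K, e' r < e r ∧ e r ≠ ⊤ ∧ 1 < (e r).val ∧
      ∀ s ∈ K, s < r → (e s).val + 1 < (e r).val := by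
  obtain ⟨r, ⟨hr, hlt⟩, hmin⟩ := exists_minimal_of_wellFoundedLT _ hne
  have lt_e'r (s : C n) (hs : s ∈ K) (hsr : s < r) : (e' s).val < (e' r).val :=
    (he'.lt_or_eq_top s hs r hr hsr).resolve_right fun h => hlt.ne_top h.2
  have eq_of_lt (s : C n) (hs : s ∈ K) (hsr : s < r) : e s = e' s :=
    le_antisymm (le_of_not_gt fun h => (hmin ⟨hs, h⟩ hsr.le).not_gt hsr) (hle s hs)
  have hlt_val : (e' r).val < (e r).val := hlt
  refine ⟨r, hr, hlt, fun h => hlt.ne_top (htop r hr h), ?_, fun s hs hsr => ?_⟩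
  · have hr_pos : ⊥ < r := bot_lt_iff_ne_bot.2 fun h => by
      rw [h, he.apply_bot, he'.apply_bot] at hlt
      exact hlt.false
    have := lt_e'r ⊥ hbot hr_pos
    omega
  · have := lt_e'r s hs hsr
    rw [eq_of_lt s hs hsr]
    omega

theorem isHomOn_shiftUp (K : Set (C n)) : IsHomOn shiftUp K where
  apply_bot := by rw [eq_bot_iff_val, val_shiftUp, eq_bot_iff_val.1 rfl]; rfl
  apply_top := by rw [eq_top_iff_val, val_shiftUp, eq_top_iff_val.1 rfl]; simp
  lt_or_eq_top a _ b _ hab := by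
    have := b.isLt
    have hab_val : a.val < b.val := hab
    rw [Fin.lt_def, eq_top_iff_val, eq_top_iff_val, val_shiftUp, val_shiftUp]
    split_ifs <;> omega

/-- If `r` is the smallest argument with `r < e r`, then `e r - 1` is not a value of `e`, and the
values from `r` on, except for the top element at other arguments, can be decreased by one. -/
def lowerFrom (e : C n → C n) (r s : C n) : C n :=
  if s < r then e s
  else if e s = ⊤ ∧ s ≠ r then ⊤
  else ⟨(e s).val - 1, (Nat.sub_le _ _).trans_lt (e s).isLt⟩

theorem val_lowerFrom (e : C n → C n) (r s : C n) :
    (lowerFrom e r s).val = if s.val < r.val then (e s).val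
      else if (e s).val = n - 1 ∧ s.val ≠ r.val then n - 1 else (e s).val - 1 := by
  simp only [lowerFrom, Fin.lt_def, Fin.ext_iff, Fin.val_top, ne_eq]
  split_ifs <;> simp

theorem lowerFrom_lt {r : C n} (hlt : r < e r) : lowerFrom e r < e := by
  have hlt_val : r.val < (e r).val := hlt
  refine Pi.lt_def.2 ⟨fun s => ?_, r, ?_⟩
  · rw [lowerFrom]
    split_ifs with _ h
    · exact le_rfl
    · exact h.1.ge
    · exact Nat.sub_le _ _
  · rw [lowerFrom, if_neg (lt_irrefl r), if_neg (fun h => h.2 rfl), Fin.lt_def]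
    dsimp only
    omega

theorem IsHomOn.bot_lt_of_lt_apply (he : IsHomOn e K) {r : C n} (h : r < e r) : ⊥ < r :=
  bot_lt_iff_ne_bot.2 fun hr => by
    rw [hr, he.apply_bot] at h
    exact h.false

theorem IsHomOn.lowerFrom (he : IsHomOn e K) {r : C n} (hr : r ∈ K) (hlt : r < e r)
    (hmin : ∀ s ∈ K, s < r → e s ≤ s) : IsHomOn (lowerFrom e r) K where
  apply_bot := by
    rw [GodelDuality.lowerFrom, if_pos (he.bot_lt_of_lt_apply hlt), he.apply_bot]
  apply_top := by
    have : r < ⊤ := hlt.trans_le le_top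
    rw [GodelDuality.lowerFrom, if_neg this.not_gt, if_pos ⟨he.apply_top, this.ne'⟩]
  lt_or_eq_top a ha b hb hab := by
    have hr_val : r.val < (e r).val := hlt
    have := (e a).isLt
    have := (e b).isLt
    have hab_val : a.val < b.val := hab
    have he_ab := he.lt_or_eq_top a ha b hb hab
    have he_a : a.val < r.val → (e a).val ≤ a.val := hmin a ha
    have he_ra : r.val ≤ a.val → (e r).val ≤ (e a).val := he.le hr ha
    have he_rb : r.val ≤ b.val → (e r).val ≤ (e b).val := he.le hr hb
    simp only [eq_top_iff_val, Fin.lt_def, val_lowerFrom] at he_ab ⊢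
    split_ifs <;> omega

variable {S : Type u} {x : S → C n} (hn : 4 ≤ n)

theorem reach_comp_of_le (hbot : ⊥ ∈ K) (hx : ∀ s, x s ∈ K) (he' : IsHomOn e' K)
    (he : IsHomOn e K) (hle : ∀ s ∈ K, e' s ≤ e s) (htop : ∀ s ∈ K, e s = ⊤ → e' s = ⊤) :
    ((alterEgo (gh₁ n hn)).pow S).Reach (e ∘ x) (e' ∘ x) := by
  induction e using WellFoundedLT.induction with
  | ind e ih =>
  by_cases hne : ∃ r, r ∈ K ∧ e' r < e r
  swap
  · push Not at hne
    have heq : e ∘ x = e' ∘ x := funext fun s => le_antisymm (hne _ (hx s)) (hle _ (hx s))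
    exact heq ▸ .refl
  obtain ⟨r, hr, hlt, hr_top, hpos, hgap⟩ := exists_room_of_lt hbot he' he hle htop hne
  obtain ⟨i, hi⟩ := exists_lowerAt_mem_gMap he hr hr_top hpos hgap
  have hstep : ((alterEgo (gh₁ n hn)).pow S).Reach (e ∘ x) (lowerAt e r ∘ x) :=
    TopStr.reach_of_mem_op (Sum.inl i) (TopStr.mem_pow_op.2 fun s => hi _ (hx s))
  have hle_lower : e' r ≤ lowerAt e r r := by
    rw [Fin.le_def, val_lowerAt_self]
    exact Nat.le_pred_of_lt hlt
  refine hstep.trans (ih _ (lowerAt_lt (by omega)) (he.lowerAt hr hr_top hpos hgap)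
    (fun s hs => ?_) fun s hs hs_top => ?_)
  · rcases eq_or_ne s r with rfl | hsr
    · exact hle_lower
    · exact (lowerAt_of_ne e hsr).symm ▸ hle s hs
  · exact htop s hs (top_unique (hs_top.ge.trans ((lowerAt_lt (by omega)).le s)))

theorem reach_shiftUp_comp (y : S → C n) :
    ((alterEgo (gh₁ n hn)).pow S).Reach y (shiftUp ∘ y) :=
  TopStr.reach_of_mem_op (Sum.inr ()) (TopStr.mem_pow_op.2 fun _ => Part.mem_some _)

theorem reach_comp (hbot : ⊥ ∈ K) (hx : ∀ s, x s ∈ K) (he : IsHomOn e K) :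
    ((alterEgo (gh₁ n hn)).pow S).Reach x (e ∘ x) := by
  induction e using WellFoundedLT.induction with
  | ind e ih =>
  by_cases hne : ∃ r, r ∈ K ∧ r < e r
  swap
  · push Not at hne
    exact reach_comp_of_le hn hbot hx he (.id K) hne fun s _ hs => hs ▸ he.apply_top
  obtain ⟨r, ⟨hr, hlt⟩, hmin⟩ := exists_minimal_of_wellFoundedLT _ hne
  have le_of_lt (s : C n) (hs : s ∈ K) (hsr : s < r) : e s ≤ s :=
    le_of_not_gt fun h => (hmin ⟨hs, h⟩ hsr.le).not_gt hsr
  have hr_pos : 0 < r.val := he.bot_lt_of_lt_apply hlt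
  have hlt_val : r.val < (e r).val := hlt
  have hlower := he.lowerFrom hr hlt le_of_lt
  refine ((ih _ (lowerFrom_lt hlt) hlower).trans (reach_shiftUp_comp hn _)).trans
    (reach_comp_of_le hn hbot hx he ((isHomOn_shiftUp _).comp hlower) (fun s hs => ?_)
      fun s hs => ?_)
  · have := (e s).isLt
    have he_ge : r.val ≤ s.val → (e r).val ≤ (e s).val := he.le hr hs
    simp only [Fin.le_def, Function.comp_apply, val_shiftUp, val_lowerFrom]
    split_ifs <;> omega
  · have := (e r).isLt
    have he_lt : s.val < r.val → (e s).val ≤ s.val := le_of_lt s hs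
    simp only [eq_top_iff_val, Function.comp_apply, val_shiftUp, val_lowerFrom]
    split_ifs <;> omega

end Reach

section Duality

variable {n : ℕ} [NeZero n] {A : Type u} [HeytingAlgebra A]

theorem reachesLargerKernels_gh₁ (hn : 4 ≤ n) : ReachesLargerKernels (gh₁ n hn) A := by
  intro x y hxy
  obtain ⟨f, rfl⟩ := exists_ofHom_eq x
  obtain ⟨g, rfl⟩ := exists_ofHom_eq y
  obtain ⟨e, he, hge⟩ := exists_isHomOn_factor f g hxy
  have hreach : ((alterEgo (gh₁ n hn)).pow A).Reach (⇑f) (⇑g) := by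
    rw [show ⇑g = e ∘ f from funext hge]
    exact reach_comp (K := Set.range f) hn ⟨⊥, map_bot f⟩ Set.mem_range_self he
  exact (hreach.to_sub (x := ofHom _ f)).2

/-- The map which sends everything above `v` to `⊤`. -/
def collapseAbove (v r : C n) : C n := if v < r then ⊤ else r

theorem isHomOn_collapseAbove (v : C n) (K : Set (C n)) : IsHomOn (collapseAbove v) K where
  apply_bot := if_neg not_lt_bot
  apply_top := ite_self ⊤
  lt_or_eq_top a _ b _ hab := by
    unfold collapseAbove
    split_ifs with ha hb hb
    · exact .inr ⟨rfl, rfl⟩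
    · exact absurd (ha.trans hab) hb
    · exact .inl (hab.trans_le le_top)
    · exact .inl hab

section Interpolation

variable {I : Type w} {R : I → PartialEnd (C n)} {φ : E R (D R A)}

theorem exists_interpolant (hR : ReachesLargerKernels R A)
    (hφ : ∀ x : (D R A).carrier, ∃ a, x.1 a = φ.toFun x) (x y : (D R A).carrier) :
    ∃ a, φ.toFun x ≤ x.1 a ∧ y.1 a ≤ φ.toFun y := by
  by_contra! hlt
  obtain ⟨f, rfl⟩ := exists_ofHom_eq y
  set v : C n := φ.toFun (ofHom R f)
  have lt_of_le (a : A) (ha : φ.toFun x ≤ x.1 a) : v < f a := lt_of_not_ge (hlt a ha)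
  obtain ⟨g, hg⟩ := (isHomOn_collapseAbove v (Set.range f)).exists_heytingHom
  have hreach_x : (D R A).Reach x (ofHom R g) := hR _ _ fun a ha =>
    (hg a).trans (if_pos (lt_of_le a (ha.symm ▸ le_top)))
  have hreach_y : (D R A).Reach (ofHom R f) (ofHom R g) := hR _ _ fun a (ha : f a = ⊤) =>
    (hg a).trans (ha ▸ (isHomOn_collapseAbove v Set.univ).apply_top)
  obtain ⟨a, ha⟩ := hφ x
  obtain ⟨b, hb⟩ := hφ (ofHom R f)
  have hva : v < f a := lt_of_le a ha.ge
  have hfb : f b = v := hb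
  have φ_top : φ.toFun (ofHom R g) = (⊤ : C n) :=
    (φ.eq_of_reach (evalHom R A a) hreach_x ha.symm).trans ((hg a).trans (if_pos hva))
  have φ_v : φ.toFun (ofHom R g) = v :=
    (φ.eq_of_reach (evalHom R A b) hreach_y hb.symm).trans
      ((hg b).trans (by rw [hfb, collapseAbove, if_neg (lt_irrefl v)]))
  exact hva.ne_top (φ_v.symm.trans φ_top)

theorem mem_range_evalHom (hR : ReachesLargerKernels R A)
    (hφ : ∀ x : (D R A).carrier, ∃ a, x.1 a = φ.toFun x) : ∃ a, evalHom R A a = φ := by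
  let T : Set ((D R A).carrier → (alterEgo R).carrier) := Set.range fun a => (evalHom R A a).toFun
  have hφT : φ.toFun ∈ T := by
    refine mem_of_forall_exists_interpolant (Set.range_nonempty _) ?_ ?_ ?_ φ.continuous_toFun ?_
    · rintro _ ⟨a, rfl⟩ _ ⟨b, rfl⟩
      exact ⟨a ⊔ b, congrArg E.val (map_sup (evalHom R A) a b)⟩
    · rintro _ ⟨a, rfl⟩ _ ⟨b, rfl⟩
      exact ⟨a ⊓ b, congrArg E.val (map_inf (evalHom R A) a b)⟩
    · rintro _ ⟨a, rfl⟩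
      exact (evalHom R A a).continuous_toFun
    · intro x y
      obtain ⟨a, ha⟩ := exists_interpolant hR hφ x y
      exact ⟨_, ⟨a, rfl⟩, ha⟩
  obtain ⟨a, ha⟩ := hφT
  exact ⟨a, E.val_injective ha⟩

end Interpolation

variable (hn : 4 ≤ n)

/-- If `φ x` is not a value of `x`, then either it is at most `n - 3` and `g_{φ x}` is defined at
`x` but not at `φ x`, or it is `n - 2` and `h₁` sends it to `⊤` without enlarging the kernel
of `x`. -/
theorem exists_apply_eq_toFun (φ : E (gh₁ n hn) (D (gh₁ n hn) A))
    (x : (D (gh₁ n hn) A).carrier) : ∃ a, x.1 a = φ.toFun x := by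
  by_contra! hne
  obtain ⟨f, rfl⟩ := exists_ofHom_eq x
  set v : C n := φ.toFun (ofHom _ f)
  have hv_bot : v.val ≠ 0 := fun h => hne ⊥ ((map_bot f).trans (eq_bot_iff_val.2 h).symm)
  have hv_top : v.val ≠ n - 1 := fun h => hne ⊤ ((map_top f).trans (eq_top_iff_val.2 h).symm)
  have hfv (a : A) : (f a).val ≠ v.val := fun h => hne a (Fin.ext h)
  have hv_lt := v.isLt
  obtain hv | hv : v.val ≤ n - 3 ∨ v.val = n - 2 := by omega
  · have hdom := φ.dom_op (i := Sum.inl ⟨v.val, by omega, hv⟩) (x := ofHom _ f) hfv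
    exact hdom rfl
  · have hop : ∃ y, y ∈ (D (gh₁ n hn) A).op (Sum.inr ()) (ofHom _ f) :=
      Part.dom_iff_mem.1 fun _ => trivial
    obtain ⟨y, hy⟩ := hop
    have hfy (a : A) : (y.1 a : C n).val =
        if 1 ≤ (f a).val ∧ (f a).val < n - 1 then (f a).val + 1 else (f a).val :=
      (mem_hMap _ _ _).1 (TopStr.mem_pow_op.1 (TopStr.mem_sub_op.1 hy) a)
    have hφy : φ.toFun y = (⊤ : C n) := by
      have hval := (mem_hMap _ _ _).1 (φ.map_op _ _ _ hy)
      rw [if_pos (by change 1 ≤ v.val ∧ v.val < n - 1; omega)] at hval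
      exact eq_top_iff_val.2 (hval.trans (by change v.val + 1 = n - 1; omega))
    have hreach : (D (gh₁ n hn) A).Reach y (ofHom _ f) :=
      reachesLargerKernels_gh₁ hn _ _ fun a ha => by
        have ha_val := (hfy a).symm.trans (eq_top_iff_val.1 ha)
        have hfa := hfv a
        refine eq_top_iff_val.2 (?_ : (f a).val = n - 1)
        split_ifs at ha_val <;> omega
    have hy_top : y.1 ⊤ = (⊤ : C n) := by
      obtain ⟨g, rfl⟩ := exists_ofHom_eq y
      exact map_top g
    exact hne ⊤ (φ.eq_of_reach (evalHom _ A ⊤) hreach (hφy.trans hy_top.symm)).symm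

theorem fullyDualises_gh₁ : FullyDualises.{u} (gh₁ n hn) :=
  ⟨fun _ _ hA => ⟨evalHom_injective _ hA, fun φ =>
      mem_range_evalHom (reachesLargerKernels_gh₁ hn) (exists_apply_eq_toFun hn φ)⟩,
    fun _ hX => nonempty_iso_of_reachesLargerKernels
      (supPrime_iff_not_isMin.2 fun h => by
        have := eq_top_iff_val.1 (isMin_iff_eq_bot.1 h).symm
        change 0 = n - 1 at this
        omega)
      (reachesLargerKernels_gh₁ hn) hX⟩

end Duality

section NonDual

variable {M : Type v} [HeytingAlgebra M] {I : Type w} {R : I → PartialEnd M} {X : Set M}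

theorem mem_op_ofHom_of_eq_bot_or_eq_top {A : Type u} [HeytingAlgebra A] {f : HeytingHom A M}
    (hf : ∀ a, f a = ⊥ ∨ f a = ⊤) (i : I) : ofHom R f ∈ (D R A).op i (ofHom R f) :=
  TopStr.mem_sub_op.2 <| TopStr.mem_pow_op.2 fun a => by
    change f a ∈ (R i).toPFun (f a)
    obtain ha | ha := hf a <;> rw [ha]
    exacts [(R i).bot_mem, (R i).top_mem]

variable {Y : TopStr.{v} I} {Z : Set Y.carrier}

theorem TopStr.IsSub.preimage_powUnit (hZ : Y.IsSub Z) :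
    (Y.pow PUnit.{u + 1}).IsSub {z | z PUnit.unit ∈ Z} :=
  fun i _ hz _ hz' => hZ i _ hz _ (TopStr.mem_pow_op.1 hz' _)

/-- A substructure of `Y` as a substructure of the first power of `Y`, in the universe which
`TopStr.InIScP.{u}` asks for. -/
def TopStr.isoSubPowUnit (hZ : Y.IsSub Z) :
    (Y.sub Z hZ).Iso ((Y.pow PUnit.{u + 1}).sub {z | z PUnit.unit ∈ Z} hZ.preimage_powUnit) where
  toHomeomorph :=
    { toFun := fun x => ⟨fun _ => x.1, x.2⟩
      invFun := fun z => ⟨z.1 PUnit.unit, z.2⟩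
      left_inv := fun _ => rfl
      right_inv := fun _ => rfl
      continuous_toFun := (continuous_pi fun _ => continuous_subtype_val).subtype_mk _
      continuous_invFun := (TopStr.continuous_coord PUnit.unit).subtype_mk _ }
  map_op_iff _ _ _ :=
    (TopStr.mem_sub_op.trans TopStr.mem_pow_op).trans <|
      (forall_const _).trans TopStr.mem_sub_op.symm

theorem IsClosedNonDual.not_fullyDualises (h : IsClosedNonDual.{max u v} R X) :
    ¬ FullyDualises.{u} R := by
  obtain ⟨hX_closed, hX, hnot⟩ := h
  rintro ⟨-, hfull⟩
  obtain ⟨Ψ⟩ := hfull _ ⟨PUnit.{u + 1}, _, TopStr.IsSub.preimage_powUnit hX,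
    hX_closed.preimage (continuous_apply PUnit.unit), ⟨Homeomorph.refl _, fun _ _ _ => Iff.rfl⟩⟩
  exact (hnot _ (inISP_E _)).false ((TopStr.isoSubPowUnit hX).trans Ψ.symm)

end NonDual

section Chain

variable {n : ℕ} [NeZero n]

/-- The map which fixes `⊥`, sends `m` to `v` and everything else to `⊤`. -/
noncomputable def collapseExcept (m v r : C n) : C n := if r = ⊥ then ⊥ else if r = m then v else ⊤

theorem isHomOn_collapseExcept {K : Set (C n)} {m v : C n} (hm : Minimal (fun r => r ∈ K ∧ r ≠ ⊥) m)
    (hm_top : m ≠ ⊤) (hv : v ≠ ⊥) : IsHomOn (collapseExcept m v) K where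
  apply_bot := if_pos rfl
  apply_top := by
    have top_ne_bot : (⊤ : C n) ≠ ⊥ := (bot_le.trans_lt hm_top.lt_top).ne'
    rw [collapseExcept, if_neg top_ne_bot, if_neg hm_top.symm]
  lt_or_eq_top r hr s _ hrs := by
    have hs_bot : s ≠ ⊥ := (bot_le.trans_lt hrs).ne'
    by_cases hr_bot : r = ⊥
    · rw [collapseExcept, collapseExcept, if_pos hr_bot, if_neg hs_bot]
      split_ifs
      · exact .inl hv.bot_lt
      · exact .inl (bot_le.trans_lt hm_top.lt_top)
    · have hs_m : s ≠ m := fun h => (hm.le_of_le ⟨hr, hr_bot⟩ (h ▸ hrs.le)).not_gt (h ▸ hrs)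
      rw [collapseExcept, collapseExcept, if_neg hr_bot, if_neg hs_bot, if_neg hs_m]
      split_ifs
      · exact (le_top (a := v)).lt_or_eq.imp_right fun h => ⟨h, rfl⟩
      · exact .inr ⟨rfl, rfl⟩

theorem exists_injective_heytingHom {A : Type u} [HeytingAlgebra A] {f : HeytingHom A (C n)} {a : A}
    (ha_bot : f a ≠ ⊥) (ha_top : f a ≠ ⊤) :
    ∃ F : {v : C n // v ≠ ⊥} → HeytingHom A (C n), Function.Injective F := by
  obtain ⟨m, hm⟩ := exists_minimal_of_wellFoundedLT
    (fun r => r ∈ Set.range f ∧ r ≠ ⊥) ⟨f a, ⟨a, rfl⟩, ha_bot⟩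
  have hm_top : m ≠ ⊤ := ((le_of_not_gt (hm.not_lt ⟨⟨a, rfl⟩, ha_bot⟩)).trans_lt ha_top.lt_top).ne
  obtain ⟨⟨b, rfl⟩, hb_bot⟩ := hm.prop
  choose F hF using fun v : {v : C n // v ≠ ⊥} =>
    (isHomOn_collapseExcept hm hm_top v.2).exists_heytingHom
  have apply_b (v : {v : C n // v ≠ ⊥}) : F v b = v := by
    rw [hF, collapseExcept, if_neg hb_bot, if_pos rfl]
  exact ⟨F, fun v w hvw => Subtype.ext (by rw [← apply_b v, hvw, apply_b])⟩

theorem isClosedNonDual_of_ncard_lt {I : Type w} {R : I → PartialEnd (C n)} {X : Set (C n)}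
    (hX : (alterEgo R).IsSub X) (hcard : X.ncard < n - 1) {i : I} {x : C n} (hx : x ∈ X)
    (hdom : ¬ ((R i).toPFun x).Dom) : IsClosedNonDual.{u} R X := by
  refine ⟨isClosed_discrete _, hX, fun A _ _ => ⟨fun Θ => ?_⟩⟩
  obtain ⟨f, hf⟩ := exists_ofHom_eq (Θ.toHomeomorph ⟨x, hx⟩)
  obtain ⟨a, ha_bot, ha_top⟩ : ∃ a, f a ≠ ⊥ ∧ f a ≠ ⊤ := by
    by_contra! hne
    have hfix := mem_op_ofHom_of_eq_bot_or_eq_top (R := R)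
      (fun a => or_iff_not_imp_left.2 (hne a)) i
    rw [hf] at hfix
    exact hdom ((Θ.map_op_iff i _ _).1 hfix).1
  obtain ⟨F, hF⟩ := exists_injective_heytingHom ha_bot ha_top
  have hinj : Function.Injective fun v => Θ.toHomeomorph.symm (ofHom R (F v)) := fun v w h =>
    hF <| DFunLike.coe_injective <| congrArg Subtype.val (Θ.toHomeomorph.symm.injective h)
  have hle : Nat.card {v : C n // v ≠ ⊥} ≤ Nat.card X := Nat.card_le_card_of_injective _ hinj
  rw [Nat.card_eq_fintype_card, Fintype.card_subtype_compl, Fintype.card_fin,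
    Fintype.card_subtype_eq, Nat.card_coe_set_eq] at hle
  omega

theorem mem_fMap (i : Set.Icc 1 (n - 3)) (x y : C n) :
    y ∈ (fMap n i).toPFun x ↔
      x.val ≠ i.1 + 1 ∧ y.val = if x.val = i.1 then i.1 + 1 else x.val := by
  rw [mem_fMap_iff, mem_gMap]
  split_ifs <;> omega

variable {σ : Idx n → PartialEnd (C n)}

theorem isSub_setOf_lt (hσ : σ ∈ SigmaTuples n) {j : Set.Icc 1 (n - 3)}
    (hj : σ (Sum.inl j) = fMap n j)
    (hg : ∀ i : Set.Icc 1 (n - 3), j < i → σ (Sum.inl i) = gMap n i) :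
    (alterEgo σ).IsSub {x : C n | j.val < x.val} := by
  rintro (i | ⟨⟩) (x : C n) (hx : j.1 < x.val) (y : C n) (hy : y ∈ (σ _).toPFun x) <;>
    change j.1 < y.val
  · rcases lt_or_ge j i with hji | hij
    · have hji_val : j.1 < i.1 := hji
      rw [hg i hji, mem_gMap] at hy
      split_ifs at hy <;> omega
    have hij_val : i.1 ≤ j.1 := hij
    rcases hσ.1 i with hi | hi
    · rw [hi, mem_fMap] at hy
      split_ifs at hy <;> omega
    · rcases hij.lt_or_eq with hlt | rfl
      · have hlt_val : i.1 < j.1 := hlt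
        rw [hi, mem_gMap] at hy
        split_ifs at hy <;> omega
      · rw [hj, mem_fMap] at hy
        split_ifs at hy <;> omega
  · obtain ⟨k, hk⟩ := hσ.2
    rw [hk, mem_hMap] at hy
    split_ifs at hy <;> omega

theorem isClosedNonDual_of_fMap (hσ : σ ∈ SigmaTuples n) {j : Set.Icc 1 (n - 3)}
    (hj : σ (Sum.inl j) = fMap n j)
    (hg : ∀ i : Set.Icc 1 (n - 3), j < i → σ (Sum.inl i) = gMap n i) :
    IsClosedNonDual.{u} σ {x : C n | j.val < x.val} := by
  obtain ⟨hj_pos, hj_le⟩ := j.2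
  refine isClosedNonDual_of_ncard_lt (i := Sum.inl j) (x := ⟨j.1 + 1, by omega⟩)
    (isSub_setOf_lt hσ hj hg) ?_ (Nat.lt_succ_self _) ?_
  · have hX : {x : C n | j.val < x.val} = ↑(Finset.Ioi (⟨j.1, by omega⟩ : Fin n)) :=
      (Finset.coe_Ioi (⟨j.1, _⟩ : Fin n)).symm
    rw [hX, Set.ncard_coe_finset, Fin.card_Ioi]
    dsimp only
    omega
  · rw [hj]
    exact fun h => h rfl

theorem isSub_setOf_eq_one_or_eq_top (hg : ∀ i : Set.Icc 1 (n - 3), σ (Sum.inl i) = gMap n i)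
    {k : Set.Icc 1 (n - 2)} (hk1 : k.val ≠ 1) (hk : σ (Sum.inr ()) = hMap n k) :
    (alterEgo σ).IsSub {x : C n | x.val = 1 ∨ x.val = n - 1} := by
  have hk_pos := k.2.1
  rintro (i | ⟨⟩) (x : C n) (hx : x.val = 1 ∨ x.val = n - 1) (y : C n) (hy : y ∈ (σ _).toPFun x) <;>
    change y.val = 1 ∨ y.val = n - 1
  · obtain ⟨hi_pos, hi_le⟩ := i.2
    rw [hg, mem_gMap] at hy
    split_ifs at hy <;> omega
  · rw [hk, mem_hMap] at hy
    split_ifs at hy <;> omega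

theorem isClosedNonDual_of_hMap (hg : ∀ i : Set.Icc 1 (n - 3), σ (Sum.inl i) = gMap n i)
    {k : Set.Icc 1 (n - 2)} (hk1 : k.val ≠ 1) (hk : σ (Sum.inr ()) = hMap n k) :
    IsClosedNonDual.{u} σ {x : C n | x.val = 1 ∨ x.val = n - 1} := by
  obtain ⟨hk_pos, hk_le⟩ := k.2
  refine isClosedNonDual_of_ncard_lt (i := Sum.inl ⟨1, le_rfl, by omega⟩) (x := ⟨1, by omega⟩)
    (isSub_setOf_eq_one_or_eq_top hg hk1 hk) ?_ (.inl rfl) ?_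
  · have hX : {x : C n | x.val = 1 ∨ x.val = n - 1} =
        {(⟨1, by omega⟩ : C n), (⟨n - 1, by omega⟩ : C n)} :=
      Set.ext fun x => or_congr (Fin.ext_iff (a := x) (b := ⟨1, _⟩)).symm
        (Fin.ext_iff (a := x) (b := ⟨n - 1, _⟩)).symm
    rw [hX]
    exact (Set.ncard_insert_le _ _).trans_lt (by rw [Set.ncard_singleton]; omega)
  · rw [hg]
    exact fun h => h rfl

theorem exists_isClosedNonDual_of_ne_gh₁ (hn : 4 ≤ n) (hσ : σ ∈ SigmaTuples n)
    (hne : σ ≠ gh₁ n hn) : ∃ X, IsClosedNonDual.{u} σ X := by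
  by_cases hg : ∀ i : Set.Icc 1 (n - 3), σ (Sum.inl i) = gMap n i
  · obtain ⟨k, hk⟩ := hσ.2
    have hk1 : k.val ≠ 1 := fun hk1 => hne <| by
      rw [show k = ⟨1, le_rfl, by omega⟩ from Subtype.ext hk1] at hk
      exact funext (Sum.rec hg fun _ => hk)
    exact ⟨_, isClosedNonDual_of_hMap hg hk1 hk⟩
  · push Not at hg
    obtain ⟨j, hj⟩ := exists_maximal_of_wellFoundedGT
      (fun i : Set.Icc 1 (n - 3) => σ (Sum.inl i) ≠ gMap n i) hg
    exact ⟨_, isClosedNonDual_of_fMap hσ ((hσ.1 j).resolve_right hj.prop)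
      fun i hji => not_not.1 (hj.not_prop_of_gt hji)⟩

end Chain

end GodelDuality

open GodelDuality in
theorem theorem5p1 (n : ℕ) [NeZero n] (hn : 4 ≤ n) (σ : Idx n → PartialEnd (C n))
    (hσ : σ ∈ SigmaTuples n) :
    (FullyDualises.{u} σ ↔ σ = gh₁ n hn) ∧
    (∀ j : Set.Icc 1 (n - 3), σ (Sum.inl j) = fMap n j →
      (∀ i : Set.Icc 1 (n - 3), j < i → σ (Sum.inl i) = gMap n i) →
        IsClosedNonDual.{u} σ {x : C n | j.val < x.val}) ∧
    ((∀ i : Set.Icc 1 (n - 3), σ (Sum.inl i) = gMap n i) →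
      ∀ k : Set.Icc 1 (n - 2), k.val ≠ 1 → σ (Sum.inr ()) = hMap n k →
        IsClosedNonDual.{u} σ {x : C n | x.val = 1 ∨ x.val = n - 1}) := by
  refine ⟨⟨fun hfull => by_contra fun hne => ?_, ?_⟩,
    fun j hj hg => isClosedNonDual_of_fMap hσ hj hg,
    fun hg k hk1 hk => isClosedNonDual_of_hMap hg hk1 hk⟩
  · obtain ⟨X, hX⟩ := exists_isClosedNonDual_of_ne_gh₁ hn hσ hne
    exact hX.not_fullyDualises hfull
  · rintro rfl
    exact fullyDualises_gh₁ hn
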